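/- Let $d\ge 3$ be an integer. There exist constants $c, C, K>0$ depending only on $d$ such that the following holds for all integers $N\ge 1$, all $\delta\in(0,1)$, all $\sigma>0$ and all $\theta^*\in\mathbb R^n$, where $n=N^d$ and vectors in $\mathbb R^n$ are indexed by the vertices $[N]^d$ of the $d$-dimensional grid. Let $D_d\in\{-1,0,1\}^{m\times n}$ be the incidence matrix of this grid: its rows are indexed by the $m$ edges, and $(D_d\theta)_{e}=\theta_{i+e_j}-\theta_{i}$ for the edge $e$ joining the vertices $i$ and $i+e_j$. Observe $y=\theta^*+\varepsilon$ with $\varepsilon\sim\mathcal N(0,\sigma^2I_n)$, put $$\lambda=\frac{c\,\sigma\sqrt{\log(en/\delta)}}{n},$$ and let the TV denoiser $\hat\theta$ be any minimizer over $\theta\in\mathbb R^n$ of $\frac1n\|\theta-y\|_2^2+\lambda\|D_d\theta\|_1$. Then, on one event of probability at least $1-2\delta$, $$\frac1n\|\hat\theta-\theta^*\|_2^2\le\inf_{\bar\theta\in\mathbb R^n,\;T\subseteq[m]}\Big\{\frac1n\|\bar\theta-\theta^*\|_2^2+4\lambda\|(D_d\bar\theta)_{T^c}\|_1+\frac{C\sigma^2}{n}\big(|T|\log(en/\delta)+\log(e/\delta)\big)\Big\},$$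 where $x_{T^c}$ is the vector that agrees with $x$ outside $T$ and vanishes on $T$. In particular, on the same event, $\mathsf{MSE}(\hat\theta)=\frac1n\|\hat\theta-\theta^*\|_2^2$ satisfies $$\mathsf{MSE}(\hat\theta)\le K\,\frac{\big(\sigma\|D_d\theta^*\|_1\wedge\sigma^2\|D_d\theta^*\|_0\big)\log(en/\delta)+\sigma^2\log(e/\delta)}{n},$$ where $\|\cdot\|_0$ is the number of nonzero components; and, if $\|D_d\theta^*\|_1\ge\sigma$, $$\mathsf{MSE}(\hat\theta)\le K\,\frac{\sigma\|D_d\theta^*\|_1\wedge\sigma^2\|D_d\theta^*\|_0}{n}\,\log(en/\delta).$$ -/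

import Mathlib

open MeasureTheory ProbabilityTheory

section TotalVariation

variable {V E : Type*} [Fintype V] [Fintype E]

/-- The `ℓ¹` norm of a real vector. -/
def l1Norm (x : E → ℝ) : ℝ := ∑ e, |x e|

open Classical in
/-- The number of nonzero components of a real vector. -/
noncomputable def l0Norm (x : E → ℝ) : ℕ := (Finset.univ.filter fun e => x e ≠ 0).card

open Classical in
/-- The restriction `x_T`: the vector that agrees with `x` on `T` and vanishes outside `T`. -/
noncomputable def restrictTo (T : Finset E) (x : E → ℝ) : E → ℝ := fun e => if e ∈ T then x e else 0

/-- The mean squared distance `(1/n) ‖θ - θ'‖₂²`, where `n` is the number of vertices. -/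
noncomputable def mse (θ θ' : EuclideanSpace ℝ V) : ℝ :=
  (1 / (Fintype.card V : ℝ)) * ‖θ - θ'‖ ^ 2

/-- The action of a matrix on a vector, `D θ`. -/
def applyMatrix (D : Matrix E V ℝ) (θ : EuclideanSpace ℝ V) : E → ℝ :=
  D.mulVec θ.ofLp

/-- The total variation objective `θ ↦ (1/n) ‖θ - y‖₂² + lam ‖D θ‖₁`. -/
noncomputable def tvObjective (D : Matrix E V ℝ) (lam : ℝ) (y θ : EuclideanSpace ℝ V) : ℝ :=
  (1 / (Fintype.card V : ℝ)) * ‖θ - y‖ ^ 2 + lam * l1Norm (applyMatrix D θ)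

/-- `θhat` is a TV denoiser of `y`: a global minimizer of the total variation objective. -/
def IsTVDenoiser (D : Matrix E V ℝ) (lam : ℝ) (y θhat : EuclideanSpace ℝ V) : Prop :=
  ∀ θ : EuclideanSpace ℝ V, tvObjective D lam y θhat ≤ tvObjective D lam y θ

end TotalVariation

/-- The vertices `[N]^d` of the `d`-dimensional grid. -/
abbrev GridVertex (d N : ℕ) : Type := Fin d → Fin N

/-- The edges of the `d`-dimensional grid: an edge `(j, i)` joins `i` to `i + e_j`, so that
`j` ranges over the directions and `i` over the vertices for which `i + e_j` is in the grid. -/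
abbrev GridEdge (d N : ℕ) : Type := {e : Fin d × GridVertex d N // (e.2 e.1 : ℕ) + 1 < N}

/-- The endpoint `i` of the edge `(j, i)`. -/
def edgeTail {d N : ℕ} (e : GridEdge d N) : GridVertex d N := e.1.2

/-- The endpoint `i + e_j` of the edge `(j, i)`. -/
def edgeHead {d N : ℕ} (e : GridEdge d N) : GridVertex d N :=
  Function.update e.1.2 e.1.1 ⟨(e.1.2 e.1.1 : ℕ) + 1, e.2⟩

/-- The incidence matrix `D_d` of the `d`-dimensional grid. The rows with first index `j` are the
block `I ⊗ ⋯ ⊗ D_1 ⊗ ⋯ ⊗ I` with the path difference operator `(D_1 x)_k = x_{k+1} - x_k` in the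
`j`-th factor: `(D_d θ)_{(j, i)} = θ_{i + e_j} - θ_i`. -/
def gridIncidence (d N : ℕ) : Matrix (GridEdge d N) (GridVertex d N) ℝ :=
  fun e v => if v = edgeHead e then 1 else if v = edgeTail e then -1 else 0

/-! ### Deterministic oracle inequality -/

section OracleInequality

variable {V E : Type*} [Fintype V]

/-! Comparing the minimizer `θhat` with an arbitrary `θ` leaves the noise term `⟨ε, u⟩`, `u = θhat -
θ`, to be controlled. If `D` has a left inverse modulo constants with columns `S e`, this term
equals `∑ e, ⟨S e, ε⟩ (D u) e` plus the contribution of the mean of `u`. When all columns have norm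
at most `ρ`, Gaussian tails and a union bound make `|⟨S e, ε⟩|` at most `lam * n / 2` for every edge
at once, so the penalty dominates the first part. What remains, the active set `T` and the mean, is
absorbed by the quadratic gain in `IsTVDenoiser.add_sq_le`, because `‖(D u)_T‖₁ ≤ √|T| ‖D u‖₂` and
`‖D u‖₂² ≤ 4 d ‖u‖²`. This is `IsTVDenoiser.mse_le`.

The heart is a `ρ` independent of `N`. The value `u v` is joined to the mean of `u` by averages over
boxes of side `1, 2, …, N` attached to `v`. Passing from side `L` to `L + 1` moves mass along edges,
by an explicit product flow whose column at each edge has norm at most `(4 / L) ^ (d / 2)`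
(`norm_boxFlow_sq_le`). Summation by parts and telescoping give the left inverse
(`isCenteringInverse_gridFlow`), and the norms are summable in `L` exactly when `d ≥ 3`
(`exists_norm_gridFlow_le`). -/

lemma applyMatrix_add (D : Matrix E V ℝ) (u v : EuclideanSpace ℝ V) :
    applyMatrix D (u + v) = applyMatrix D u + applyMatrix D v := by
  simp [applyMatrix, Matrix.mulVec_add]

lemma applyMatrix_smul (D : Matrix E V ℝ) (a : ℝ) (u : EuclideanSpace ℝ V) :
    applyMatrix D (a • u) = a • applyMatrix D u := by
  simp [applyMatrix, Matrix.mulVec_smul]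

variable [Fintype E]

lemma l1Norm_nonneg (x : E → ℝ) : 0 ≤ l1Norm x :=
  Finset.sum_nonneg fun _ _ => abs_nonneg _

lemma l1Norm_midpoint_le (x y : E → ℝ) :
    l1Norm ((1 / 2 : ℝ) • x + (1 / 2 : ℝ) • y) ≤ (l1Norm x + l1Norm y) / 2 := by
  unfold l1Norm
  rw [← Finset.sum_add_distrib, Finset.sum_div]
  refine Finset.sum_le_sum fun e _ => ?_
  simp only [Pi.add_apply, Pi.smul_apply, smul_eq_mul]
  refine (abs_add_le _ _).trans (le_of_eq ?_)
  rw [abs_mul, abs_mul, abs_of_pos (by norm_num : (0 : ℝ) < 1 / 2)]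
  ring

/-- Comparing a minimizer with the midpoint of the segment joining it to `θ` improves the
minimality inequality by a quadratic term. -/
lemma IsTVDenoiser.add_sq_le {D : Matrix E V ℝ} {lam : ℝ} (hlam : 0 ≤ lam)
    {y θhat : EuclideanSpace ℝ V} (h : IsTVDenoiser D lam y θhat) (θ : EuclideanSpace ℝ V) :
    tvObjective D lam y θhat + 1 / (2 * (Fintype.card V : ℝ)) * ‖θhat - θ‖ ^ 2
      ≤ tvObjective D lam y θ := by
  have hmid := h ((1 / 2 : ℝ) • θhat + (1 / 2 : ℝ) • θ)
  have hl := l1Norm_midpoint_le (applyMatrix D θhat) (applyMatrix D θ)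
  rw [← applyMatrix_smul, ← applyMatrix_smul, ← applyMatrix_add] at hl
  have hl' := mul_le_mul_of_nonneg_left hl hlam
  have hsq : ‖((1 / 2 : ℝ) • θhat + (1 / 2 : ℝ) • θ) - y‖ ^ 2
      = (‖θhat - y‖ ^ 2 + ‖θ - y‖ ^ 2) / 2 - ‖θhat - θ‖ ^ 2 / 4 := by
    have h1 : ((1 / 2 : ℝ) • θhat + (1 / 2 : ℝ) • θ) - y
        = (1 / 2 : ℝ) • ((θhat - y) + (θ - y)) := by
      module
    have h2 : θhat - θ = (θhat - y) - (θ - y) := by abel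
    rw [h1, h2, norm_smul, mul_pow, norm_add_sq_real, norm_sub_sq_real (θhat - y)]
    norm_num
    ring
  unfold tvObjective at hmid ⊢
  rw [hsq] at hmid
  have hc : 1 / (2 * (Fintype.card V : ℝ)) = 1 / (Fintype.card V : ℝ) / 2 := by ring
  rw [hc]
  linarith

lemma sum_abs_finset_le_sqrt {x : E → ℝ} (T : Finset E) :
    ∑ e ∈ T, |x e| ≤ √(T.card * ∑ e, x e ^ 2) := by
  apply Real.le_sqrt_of_sq_le
  refine sq_sum_le_card_mul_sum_sq.trans ?_
  simp only [sq_abs]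
  gcongr
  exact Finset.subset_univ T

lemma l1Norm_restrictTo_compl [DecidableEq E] (T : Finset E) (x : E → ℝ) :
    l1Norm (restrictTo Tᶜ x) = ∑ e ∈ Tᶜ, |x e| := by
  unfold l1Norm restrictTo
  rw [← Finset.sum_filter_add_sum_filter_not Finset.univ (fun e => e ∈ Tᶜ)]
  have h1 : (Finset.univ.filter fun e => e ∈ Tᶜ) = Tᶜ := by ext; simp
  have h2 : ∑ e with e ∉ Tᶜ, |(if e ∈ Tᶜ then x e else 0)| = 0 := by
    refine Finset.sum_eq_zero fun e he => ?_
    rw [if_neg (Finset.mem_filter.1 he).2, abs_zero]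
  have h3 : ∑ e ∈ Tᶜ, |(if e ∈ Tᶜ then x e else 0)| = ∑ e ∈ Tᶜ, |x e| :=
    Finset.sum_congr rfl fun e he => by rw [if_pos he]
  convert add_zero _ using 2 <;> simp_all

/-- Termwise triangle inequality: `|u| + |x| - |x + u|` is at most `2 |u|`, used on `T`, and at most
`2 |x|`, used off `T`. Keeping the whole of `l1Norm u` on the left leaves room to absorb the noise.
-/
lemma l1Norm_add_sub_le [DecidableEq E] (T : Finset E) (x u : E → ℝ) :
    l1Norm u + l1Norm x - l1Norm (x + u)
      ≤ 2 * ∑ e ∈ T, |u e| + 2 * l1Norm (restrictTo Tᶜ x) := by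
  rw [l1Norm_restrictTo_compl]
  unfold l1Norm
  rw [← Finset.sum_add_distrib, ← Finset.sum_sub_distrib, ← Finset.sum_add_sum_compl T,
    Finset.mul_sum, Finset.mul_sum]
  refine add_le_add (Finset.sum_le_sum fun e _ => ?_) (Finset.sum_le_sum fun e _ => ?_)
  · have := abs_sub (x e + u e) (u e)
    simp only [add_sub_cancel_right] at this
    simp only [Pi.add_apply]; linarith
  · have := abs_sub (x e + u e) (x e)
    simp only [add_sub_cancel_left] at this
    simp only [Pi.add_apply]; linarith

/-- The columns `S e` form a left inverse of `D` up to constants: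
`u v - (mean of u) = ∑ e, S e v * (D u) e`. -/
def IsCenteringInverse (D : Matrix E V ℝ) (S : E → EuclideanSpace ℝ V) : Prop :=
  ∀ (u : EuclideanSpace ℝ V) (v : V),
    u v - (∑ w, u w) / (Fintype.card V : ℝ) = ∑ e, S e v * applyMatrix D u e

/-- Splitting `u` into its mean and `∑ e, S e * (D u) e` separates the noise: Hölder (`ℓ^∞`–`ℓ¹`)
handles the edge part, and Cauchy–Schwarz, `|∑ u| ≤ √n ‖u‖`, the mean. -/
lemma IsCenteringInverse.inner_le [Nonempty V] {D : Matrix E V ℝ} {S : E → EuclideanSpace ℝ V}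
    (hS : IsCenteringInverse D S) {ε : EuclideanSpace ℝ V} {τ R : ℝ}
    (hτ : ∀ e, |inner ℝ (S e) ε| ≤ τ) (hR : |∑ v, ε v| ≤ R * √(Fintype.card V : ℝ))
    (u : EuclideanSpace ℝ V) :
    inner ℝ ε u ≤ τ * l1Norm (applyMatrix D u) + R * ‖u‖ := by
  have hn : (0 : ℝ) < Fintype.card V := by exact_mod_cast Fintype.card_pos
  have hsum : inner ℝ ε u = ∑ e, inner ℝ (S e) ε * applyMatrix D u e
      + (∑ v, ε v) * ((∑ w, u w) / (Fintype.card V : ℝ)) := by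
    have h1 : ∀ e, inner ℝ (S e) ε * applyMatrix D u e
        = ∑ v, ε v * (S e v * applyMatrix D u e) := by
      intro e
      rw [PiLp.inner_apply, Finset.sum_mul]
      refine Finset.sum_congr rfl fun v _ => ?_
      simp only [RCLike.inner_apply, conj_trivial]
      ring
    simp_rw [h1]
    rw [Finset.sum_comm, Finset.sum_mul, ← Finset.sum_add_distrib, PiLp.inner_apply]
    refine Finset.sum_congr rfl fun v _ => ?_
    rw [← Finset.mul_sum, ← hS u v]
    simp only [RCLike.inner_apply, conj_trivial]
    ring
  have h2 : ∑ e, inner ℝ (S e) ε * applyMatrix D u e ≤ τ * l1Norm (applyMatrix D u) := by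
    rw [l1Norm, Finset.mul_sum]
    refine Finset.sum_le_sum fun e _ => (le_abs_self _).trans ?_
    rw [abs_mul]
    exact mul_le_mul_of_nonneg_right (hτ e) (abs_nonneg _)
  have h3 : |∑ w, u w| ≤ √(Fintype.card V : ℝ) * ‖u‖ := by
    refine (Finset.abs_sum_le_sum_abs _ _).trans ((sum_abs_finset_le_sqrt _).trans ?_)
    rw [Real.sqrt_mul (by positivity), EuclideanSpace.norm_eq]
    simp
  have h4 : (∑ v, ε v) * ((∑ w, u w) / (Fintype.card V : ℝ)) ≤ R * ‖u‖ := by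
    refine (le_abs_self _).trans ?_
    rw [abs_mul, abs_div, abs_of_pos hn]
    calc |∑ v, ε v| * (|∑ w, u w| / (Fintype.card V : ℝ))
        ≤ (R * √(Fintype.card V : ℝ)) * (√(Fintype.card V : ℝ) * ‖u‖ / (Fintype.card V : ℝ)) := by
          refine mul_le_mul hR (by gcongr) (by positivity) ((abs_nonneg _).trans hR)
      _ = R * ‖u‖ := by
          have := Real.mul_self_sqrt hn.le
          field_simp
          linear_combination R * ‖u‖ * this
  linarith

/-- The deterministic oracle inequality for the TV denoiser. -/
theorem IsTVDenoiser.mse_le [Nonempty V] {D : Matrix E V ℝ} {S : E → EuclideanSpace ℝ V}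
    (hS : IsCenteringInverse D S) {b : ℝ}
    (hb : 0 ≤ b) (hD : ∀ u, ∑ e, applyMatrix D u e ^ 2 ≤ b * ‖u‖ ^ 2) {lam : ℝ} (hlam : 0 ≤ lam)
    {θstar ε θhat : EuclideanSpace ℝ V} {R : ℝ}
    (hτ : ∀ e, |inner ℝ (S e) ε| ≤ lam * (Fintype.card V : ℝ) / 2)
    (hR : |∑ v, ε v| ≤ R * √(Fintype.card V : ℝ))
    (h : IsTVDenoiser D lam (θstar + ε) θhat) (θ : EuclideanSpace ℝ V) (T : Finset E)
    [DecidableEq E] :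
    mse θhat θstar ≤ mse θ θstar + 2 * lam * l1Norm (restrictTo Tᶜ (applyMatrix D θ))
      + 4 * R ^ 2 / (Fintype.card V : ℝ) + 4 * b * (Fintype.card V : ℝ) * lam ^ 2 * T.card := by
  have hn : (0 : ℝ) < Fintype.card V := by exact_mod_cast Fintype.card_pos
  set n : ℝ := (Fintype.card V : ℝ) with hn_def
  set u := θhat - θ with hu
  have hmin := h.add_sq_le hlam θ
  have hDu : applyMatrix D θhat = applyMatrix D θ + applyMatrix D u := by
    rw [← applyMatrix_add, hu]; congr 1; abel
  have hin := hS.inner_le hτ hR u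
  have hl1 := l1Norm_add_sub_le T (applyMatrix D θ) (applyMatrix D u)
  rw [← hDu] at hl1
  have hexp : ‖θhat - (θstar + ε)‖ ^ 2 - ‖θ - (θstar + ε)‖ ^ 2
      = ‖θhat - θstar‖ ^ 2 - ‖θ - θstar‖ ^ 2 - 2 * inner ℝ ε u := by
    have h1 : θhat - (θstar + ε) = (θhat - θstar) - ε := by abel
    have h2 : θ - (θstar + ε) = (θ - θstar) - ε := by abel
    have h3 : u = (θhat - θstar) - (θ - θstar) := by rw [hu]; abel
    rw [h1, h2, h3, norm_sub_sq_real (θhat - θstar) ε, norm_sub_sq_real (θ - θstar) ε,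
      inner_sub_right, real_inner_comm ε, real_inner_comm ε]
    ring
  have hT : 0 ≤ ∑ e ∈ T, |applyMatrix D u e| := Finset.sum_nonneg fun _ _ => abs_nonneg _
  have hTsq : (∑ e ∈ T, |applyMatrix D u e|) ^ 2 ≤ T.card * (b * ‖u‖ ^ 2) := by
    have h1 := sum_abs_finset_le_sqrt (x := applyMatrix D u) T
    have h0 : 0 ≤ ∑ e, applyMatrix D u e ^ 2 := Finset.sum_nonneg fun _ _ => sq_nonneg _
    calc (∑ e ∈ T, |applyMatrix D u e|) ^ 2 ≤ √(T.card * ∑ e, applyMatrix D u e ^ 2) ^ 2 := by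
          gcongr
      _ = T.card * ∑ e, applyMatrix D u e ^ 2 := Real.sq_sqrt (by positivity)
      _ ≤ _ := by gcongr; exact hD u
  set s := ∑ e ∈ T, |applyMatrix D u e| with hs
  have hnorm : 0 ≤ ‖u‖ := norm_nonneg u
  -- Young's inequality. The gain `‖u‖² / (2n)` is cut into two quarters, one for the active set
  -- here and one for the mean of the noise in `hquad'`.
  have hquad : 2 * lam * s ≤ 1 / (4 * n) * ‖u‖ ^ 2 + 4 * b * n * lam ^ 2 * T.card := by
    have hs1 : s ≤ √(T.card * b) * ‖u‖ := by
      refine (sq_le_sq₀ hT (by positivity)).1 (hTsq.trans (le_of_eq ?_))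
      rw [mul_pow, Real.sq_sqrt (by positivity)]; ring
    have h1 : 0 ≤ (‖u‖ / 2 - 2 * n * lam * √(T.card * b)) ^ 2 / n := by positivity
    have h2 : (‖u‖ / 2 - 2 * n * lam * √(T.card * b)) ^ 2 / n = 1 / (4 * n) * ‖u‖ ^ 2
        + 4 * n * lam ^ 2 * √(T.card * b) ^ 2 - 2 * lam * (√(T.card * b) * ‖u‖) := by
      field_simp; ring
    rw [Real.sq_sqrt (by positivity)] at h2
    have h3 := mul_le_mul_of_nonneg_left hs1 hlam
    linarith
  have hquad' : 2 / n * (R * ‖u‖) ≤ 1 / (4 * n) * ‖u‖ ^ 2 + 4 * R ^ 2 / n := by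
    have : 0 ≤ (‖u‖ / 2 - 2 * R) ^ 2 / n := by positivity
    have e : (‖u‖ / 2 - 2 * R) ^ 2 / n
      = 1 / (4 * n) * ‖u‖ ^ 2 + 4 * R ^ 2 / n - 2 / n * (R * ‖u‖) := by
      field_simp; ring
    linarith
  have hin' : 2 / n * inner ℝ ε u ≤ lam * l1Norm (applyMatrix D u) + 2 / n * (R * ‖u‖) := by
    have := mul_le_mul_of_nonneg_left hin (by positivity : (0 : ℝ) ≤ 2 / n)
    refine this.trans (le_of_eq ?_)
    field_simp
  have hl1' := mul_le_mul_of_nonneg_left hl1 hlam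
  unfold tvObjective at hmin
  unfold mse
  rw [← hn_def] at hmin ⊢
  have hexp' : 1 / n * ‖θhat - (θstar + ε)‖ ^ 2 - 1 / n * ‖θ - (θstar + ε)‖ ^ 2
      = 1 / n * ‖θhat - θstar‖ ^ 2 - 1 / n * ‖θ - θstar‖ ^ 2 - 2 / n * inner ℝ ε u := by
    rw [← mul_sub, hexp]; ring
  have hhalf : 1 / (2 * n) * ‖u‖ ^ 2 = 1 / (4 * n) * ‖u‖ ^ 2 + 1 / (4 * n) * ‖u‖ ^ 2 := by
    field_simp; ring
  linarith

end OracleInequality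

/-! ### Gaussian tails of linear functionals of the noise -/

section GaussianTail

variable {V Ω : Type*} [Fintype V] [DecidableEq V] [MeasurableSpace Ω] {P : Measure Ω}

lemma map_inner_multivariateGaussian_smul_one (σ : ℝ) (u : EuclideanSpace ℝ V) :
    (multivariateGaussian 0 (σ ^ 2 • (1 : Matrix V V ℝ))).map (fun x => inner ℝ u x)
      = gaussianReal 0 (σ ^ 2 * ‖u‖ ^ 2).toNNReal := by
  have hS : (σ ^ 2 • (1 : Matrix V V ℝ)).PosSemidef :=
    Matrix.PosSemidef.one.smul (sq_nonneg σ)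
  have hvar : Var[fun x => inner ℝ u x; multivariateGaussian 0 (σ ^ 2 • (1 : Matrix V V ℝ))]
      = σ ^ 2 * ‖u‖ ^ 2 := by
    rw [← covariance_self (Measurable.aemeasurable (by fun_prop)),
      ← covarianceBilin_apply_eq_cov IsGaussian.memLp_two_id,
      covarianceBilin_multivariateGaussian hS, Matrix.smul_mulVec, Matrix.one_mulVec,
      dotProduct_smul, EuclideanSpace.real_norm_sq_eq]
    simp [dotProduct, sq]
  have hmap := IsGaussian.map_eq_gaussianReal
    (μ := multivariateGaussian 0 (σ ^ 2 • (1 : Matrix V V ℝ))) (innerSL ℝ u)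
  have hmean : ∫ x, innerSL ℝ u x ∂multivariateGaussian 0 (σ ^ 2 • (1 : Matrix V V ℝ)) = 0 := by
    simp only [innerSL_apply_apply]
    rw [integral_inner IsGaussian.integrable_fun_id, integral_id_multivariateGaussian,
      inner_zero_right]
  rw [hmean] at hmap
  rw [← hvar]
  exact hmap

/-- Allowing any `c` above the variance lets one tail bound serve all columns of norm at most `ρ`,
including zero columns. -/
lemma hasSubgaussianMGF_inner {ε : Ω → EuclideanSpace ℝ V} {σ : ℝ}
    (hε : HasLaw ε (multivariateGaussian 0 (σ ^ 2 • (1 : Matrix V V ℝ))) P)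
    (u : EuclideanSpace ℝ V) {c : NNReal} (hc : σ ^ 2 * ‖u‖ ^ 2 ≤ c) :
    HasSubgaussianMGF (fun ω => inner ℝ u (ε ω)) c P := by
  have hlaw : HasLaw (fun ω => inner ℝ u (ε ω))
      (gaussianReal 0 (σ ^ 2 * ‖u‖ ^ 2).toNNReal) P :=
    HasLaw.fun_comp (Y := fun x => inner ℝ u x)
      ⟨Measurable.aemeasurable (by fun_prop), map_inner_multivariateGaussian_smul_one σ u⟩ hε
  constructor
  · intro t
    have h := integrable_exp_mul_gaussianReal (μ := 0)
      (v := (σ ^ 2 * ‖u‖ ^ 2).toNNReal) t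
    rw [← hlaw.map_eq, integrable_map_measure (by fun_prop) hlaw.aemeasurable] at h
    exact h
  · intro t
    rw [mgf_gaussianReal hlaw.map_eq, Real.coe_toNNReal _ (by positivity)]
    apply Real.exp_le_exp.2
    rw [zero_mul, zero_add]
    gcongr

lemma measure_le_abs_inner_le [IsFiniteMeasure P] {ε : Ω → EuclideanSpace ℝ V} {σ : ℝ}
    (hε : HasLaw ε (multivariateGaussian 0 (σ ^ 2 • (1 : Matrix V V ℝ))) P)
    {u : EuclideanSpace ℝ V} {ρ t : ℝ} (hu : ‖u‖ ≤ ρ) (ht : 0 ≤ t) :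
    P {ω | t ≤ |inner ℝ u (ε ω)|}
      ≤ ENNReal.ofReal (2 * Real.exp (-t ^ 2 / (2 * (σ * ρ) ^ 2))) := by
  have hc : σ ^ 2 * ‖u‖ ^ 2 ≤ ((σ * ρ) ^ 2).toNNReal := by
    rw [Real.coe_toNNReal _ (by positivity), mul_pow]
    gcongr
  have hsub := hasSubgaussianMGF_inner hε u hc
  have h1 := hsub.measure_ge_le ht
  have h2 := hsub.neg.measure_ge_le ht
  rw [Real.coe_toNNReal _ (by positivity)] at h1 h2
  have hle : P.real {ω | t ≤ |inner ℝ u (ε ω)|}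
      ≤ 2 * Real.exp (-t ^ 2 / (2 * (σ * ρ) ^ 2)) := by
    rw [two_mul]
    refine le_trans ?_ (add_le_add h1 h2)
    refine le_trans (measureReal_mono ?_) (measureReal_union_le _ _)
    intro ω hω
    simpa [le_abs] using hω
  rw [← ofReal_measureReal]
  exact ENNReal.ofReal_le_ofReal hle

end GaussianTail

/-! ### One-dimensional windows and the flows between them -/

section Window

/-- The distribution function, at `i`, of the uniform distribution on the window of length `L`
in `{0, …, N - 1}` attached to `x`; the window starts at `min x (N - L)`. -/
noncomputable def windowCdf (N L x i : ℕ) : ℝ := (min L (i - min x (N - L)) : ℕ) / (L : ℝ)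

/-- The uniform weight of `y` in the window of length `L` attached to `x`. -/
noncomputable def windowWeight (N L x y : ℕ) : ℝ := windowCdf N L x (y + 1) - windowCdf N L x y

/-- The difference of the distribution functions of two consecutive windows. -/
noncomputable def windowFlow (N L x i : ℕ) : ℝ := windowCdf N L x i - windowCdf N (L + 1) x i

lemma windowCdf_zero (N L x : ℕ) : windowCdf N L x 0 = 0 := by simp [windowCdf]

lemma windowCdf_self {N L : ℕ} (hL : 1 ≤ L) (hLN : L ≤ N) (x : ℕ) : windowCdf N L x N = 1 := by
  have h : min L (N - min x (N - L)) = L := by omega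
  rw [windowCdf, h]
  exact div_self (by positivity)

lemma windowFlow_zero (N L x : ℕ) : windowFlow N L x 0 = 0 := by
  simp [windowFlow, windowCdf_zero]

lemma windowFlow_self {N L : ℕ} (hL : 1 ≤ L) (hLN : L + 1 ≤ N) (x : ℕ) :
    windowFlow N L x N = 0 := by
  rw [windowFlow, windowCdf_self hL (by omega), windowCdf_self (by omega) hLN, sub_self]

lemma windowWeight_sub_windowWeight (N L x y : ℕ) :
    windowWeight N L x y - windowWeight N (L + 1) x y
      = windowFlow N L x (y + 1) - windowFlow N L x y := by
  unfold windowWeight windowFlow; ring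

lemma windowWeight_one {N x y : ℕ} (hx : x < N) :
    windowWeight N 1 x y = if x = y then 1 else 0 := by
  have hs : min x (N - 1) = x := by omega
  rw [windowWeight, windowCdf, windowCdf, hs, ← sub_div, Nat.cast_one, div_one]
  split_ifs with h
  · subst h; simp
  · have : min 1 (y + 1 - x) = min 1 (y - x) := by omega
    rw [this, sub_self]

lemma windowWeight_full {N x y : ℕ} (hy : y < N) : windowWeight N N x y = 1 / (N : ℝ) := by
  have h1 : min N (y + 1 - min x (N - N)) = y + 1 := by omega
  have h2 : min N (y - min x (N - N)) = y := by omega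
  rw [windowWeight, windowCdf, windowCdf, h1, h2, ← sub_div]
  push_cast
  ring

lemma abs_windowWeight_le (N L x y : ℕ) : |windowWeight N L x y| ≤ 1 / (L : ℝ) := by
  rw [windowWeight, windowCdf, windowCdf, ← sub_div, abs_div, Nat.abs_cast]
  gcongr
  have h : min L (y + 1 - min x (N - L)) = min L (y - min x (N - L))
      ∨ min L (y + 1 - min x (N - L)) = min L (y - min x (N - L)) + 1 := by omega
  rcases h with h | h <;> rw [h] <;> simp

lemma mem_window_of_windowWeight_ne_zero {N L x y : ℕ} (h : windowWeight N L x y ≠ 0) :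
    min x (N - L) ≤ y ∧ y < min x (N - L) + L := by
  by_contra hcon
  apply h
  have : min L (y + 1 - min x (N - L)) = min L (y - min x (N - L)) := by omega
  rw [windowWeight, windowCdf, windowCdf, this, sub_self]

lemma abs_windowFlow_le {N L : ℕ} (hL : 1 ≤ L) (hLN : L + 1 ≤ N) (x i : ℕ) :
    |windowFlow N L x i| ≤ 1 / (L : ℝ) := by
  have hL0 : (0 : ℝ) < L := by exact_mod_cast hL
  have hk : min L (i - min x (N - L)) ≤ L := min_le_left _ _
  -- The two windows are nested and differ by one end point, so the truncated counts differ by `0`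
  -- or `1`.
  have h : min (L + 1) (i - min x (N - (L + 1))) = min L (i - min x (N - L))
      ∨ min (L + 1) (i - min x (N - (L + 1))) = min L (i - min x (N - L)) + 1 := by omega
  rw [windowFlow, windowCdf, windowCdf]
  generalize min L (i - min x (N - L)) = k at *
  have hkL : (k : ℝ) ≤ L := by exact_mod_cast hk
  have hk0 : (0 : ℝ) ≤ k := by positivity
  rcases h with h | h
  · have e : (k : ℝ) / L - (k : ℝ) / ((L + 1 : ℕ) : ℝ) = k / (L + 1) / L := by
      push_cast; field_simp; ring
    rw [h, e, abs_of_nonneg (by positivity)]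
    gcongr
    rw [div_le_one (by positivity)]
    linarith
  · have e : (k : ℝ) / L - ((k + 1 : ℕ) : ℝ) / ((L + 1 : ℕ) : ℝ) = -((L - k) / (L + 1) / L) := by
      push_cast; field_simp; ring
    rw [h, e, abs_neg, abs_of_nonneg (by have := sub_nonneg.2 hkL; positivity)]
    gcongr
    rw [div_le_one (by positivity)]
    linarith

lemma mem_window_of_windowFlow_ne_zero {N L x i : ℕ} (hL : 1 ≤ L) (hLN : L + 1 ≤ N)
    (h : windowFlow N L x i ≠ 0) :
    min x (N - (L + 1)) ≤ i ∧ i < min x (N - (L + 1)) + (L + 1) := by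
  have hL0 : (L : ℝ) ≠ 0 := by positivity
  by_contra hcon
  apply h
  rw [windowFlow, windowCdf, windowCdf]
  -- Off the longer window both distribution functions equal `0`, or both equal `1`.
  have h : min L (i - min x (N - L)) = 0 ∧ min (L + 1) (i - min x (N - (L + 1))) = 0
      ∨ min L (i - min x (N - L)) = L ∧ min (L + 1) (i - min x (N - (L + 1))) = L + 1 := by omega
  rcases h with ⟨h1, h2⟩ | ⟨h1, h2⟩ <;> rw [h1, h2]
  · simp
  · rw [div_self hL0, div_self (by positivity), sub_self]

/-- Windows pushed back by the right boundary come from the last `M` points; any other window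
containing `y` starts at one of the `M` points ending at `y`. -/
lemma card_window_le (N M y : ℕ) :
    (Finset.univ.filter fun x : Fin N =>
      min (x : ℕ) (N - M) ≤ y ∧ y < min (x : ℕ) (N - M) + M).card ≤ 2 * M := by
  rw [← Finset.card_map Fin.valEmbedding]
  have hsub : (Finset.univ.filter fun x : Fin N =>
      min (x : ℕ) (N - M) ≤ y ∧ y < min (x : ℕ) (N - M) + M).map Fin.valEmbedding
      ⊆ Finset.Ico (N - M) N ∪ Finset.Ico (y + 1 - M) (y + 1) := by
    intro z hz
    simp only [Finset.mem_map, Finset.mem_filter, Finset.mem_univ, true_and,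
      Fin.valEmbedding_apply] at hz
    obtain ⟨x, hx, rfl⟩ := hz
    have := x.2
    simp only [Finset.mem_union, Finset.mem_Ico]
    omega
  refine (Finset.card_le_card hsub).trans ((Finset.card_union_le _ _).trans ?_)
  simp only [Nat.card_Ico]
  omega

/-- The sum runs over the attached point `x` with the position `y` fixed, since the norm of a column
is a sum over the vertices to which boxes are attached. -/
lemma sum_sq_le_of_window_support {N M y : ℕ} {f : ℕ → ℝ} {B : ℝ} (hB : ∀ x, |f x| ≤ B)
    (hf : ∀ x, f x ≠ 0 → min x (N - M) ≤ y ∧ y < min x (N - M) + M) :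
    ∑ x : Fin N, f x ^ 2 ≤ 2 * M * B ^ 2 := by
  classical
  have h1 : ∑ x : Fin N, f x ^ 2 = ∑ x ∈ Finset.univ.filter fun x : Fin N =>
      min (x : ℕ) (N - M) ≤ y ∧ y < min (x : ℕ) (N - M) + M, f x ^ 2 := by
    symm
    apply Finset.sum_filter_of_ne
    intro x _ hx
    exact hf x fun h => hx (by rw [h]; ring)
  rw [h1]
  refine (Finset.sum_le_card_nsmul _ _ (B ^ 2) fun x _ => ?_).trans ?_
  · rw [← sq_abs]
    exact pow_le_pow_left₀ (abs_nonneg _) (hB x) 2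
  · rw [nsmul_eq_mul]
    gcongr
    exact_mod_cast card_window_le N M y

lemma sum_windowWeight_sq_le (N L y : ℕ) (hL : 1 ≤ L) :
    ∑ x : Fin N, windowWeight N L x y ^ 2 ≤ 4 / (L : ℝ) := by
  have hL0 : (0 : ℝ) < L := by exact_mod_cast hL
  refine (sum_sq_le_of_window_support (fun x => abs_windowWeight_le N L x y)
    fun x => mem_window_of_windowWeight_ne_zero).trans ?_
  rw [div_pow, one_pow, le_div_iff₀ hL0]
  field_simp
  norm_num

lemma sum_windowFlow_sq_le {N L : ℕ} (hL : 1 ≤ L) (hLN : L + 1 ≤ N) (i : ℕ) :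
    ∑ x : Fin N, windowFlow N L x i ^ 2 ≤ 4 / (L : ℝ) := by
  have hL1 : (1 : ℝ) ≤ L := by exact_mod_cast hL
  refine (sum_sq_le_of_window_support (fun x => abs_windowFlow_le hL hLN x i)
    fun x => mem_window_of_windowFlow_ne_zero hL hLN).trans ?_
  rw [div_pow, one_pow, le_div_iff₀ (by linarith)]
  push_cast
  field_simp
  linarith

end Window

/-! ### The grid: edges, norm of the incidence operator, summation by parts -/

section Grid

variable {d N : ℕ}

lemma edgeHead_apply_self (e : GridEdge d N) : (edgeHead e e.1.1 : ℕ) = edgeTail e e.1.1 + 1 := by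
  simp [edgeHead, edgeTail]

lemma edgeHead_ne_edgeTail (e : GridEdge d N) : edgeHead e ≠ edgeTail e := by
  intro h
  have := edgeHead_apply_self e
  rw [h] at this
  omega

lemma applyMatrix_gridIncidence (u : EuclideanSpace ℝ (GridVertex d N)) (e : GridEdge d N) :
    applyMatrix (gridIncidence d N) u e = u (edgeHead e) - u (edgeTail e) := by
  have h : ∀ v, gridIncidence d N e v * u v
      = (if v = edgeHead e then u v else 0) - (if v = edgeTail e then u v else 0) := by
    intro v
    unfold gridIncidence
    by_cases h1 : v = edgeHead e
    · have h2 : v ≠ edgeTail e := by rw [h1]; exact edgeHead_ne_edgeTail e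
      rw [if_pos h1, if_pos h1, if_neg h2, one_mul, sub_zero]
    · rw [if_neg h1, if_neg h1]
      split_ifs <;> simp
  change ∑ v, gridIncidence d N e v * u v = _
  simp_rw [h]
  rw [Finset.sum_sub_distrib, Finset.sum_ite_eq' Finset.univ, Finset.sum_ite_eq' Finset.univ]
  simp

lemma sum_edgeTail (φ : Fin d → GridVertex d N → ℝ) :
    ∑ e : GridEdge d N, φ e.1.1 (edgeTail e)
      = ∑ j, ∑ w : GridVertex d N, if (w j : ℕ) + 1 < N then φ j w else 0 := by
  rw [← Fintype.sum_prod_type' (f := fun j (w : GridVertex d N) =>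
    if (w j : ℕ) + 1 < N then φ j w else 0), ← Finset.sum_filter]
  exact (Finset.sum_subtype _ (by simp) fun p : Fin d × GridVertex d N => φ p.1 p.2).symm

/-- An edge is determined by its direction and its head. -/
def edgeHeadEquiv (d N : ℕ) :
    GridEdge d N ≃ {p : Fin d × GridVertex d N // 0 < (p.2 p.1 : ℕ)} where
  toFun e := ⟨(e.1.1, edgeHead e), by simp [edgeHead]⟩
  invFun p := ⟨(p.1.1, Function.update p.1.2 p.1.1
    ⟨(p.1.2 p.1.1 : ℕ) - 1, by have := (p.1.2 p.1.1).2; omega⟩), by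
      have := (p.1.2 p.1.1).2
      have := p.2
      simp only [Function.update_self]
      omega⟩
  left_inv e := by
    apply Subtype.ext
    refine Prod.ext rfl ?_
    simp [edgeHead]
  right_inv p := by
    apply Subtype.ext
    refine Prod.ext rfl ?_
    have := p.2
    simp only [edgeHead, Function.update_self, Function.update_idem]
    refine Function.update_eq_iff.2 ⟨Fin.ext ?_, fun _ _ => rfl⟩
    simp only
    omega

lemma sum_edgeHead (φ : Fin d → GridVertex d N → ℝ) :
    ∑ e : GridEdge d N, φ e.1.1 (edgeHead e)
      = ∑ j, ∑ w : GridVertex d N, if 0 < (w j : ℕ) then φ j w else 0 := by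
  rw [← Fintype.sum_prod_type' (f := fun j (w : GridVertex d N) =>
    if 0 < (w j : ℕ) then φ j w else 0), ← Finset.sum_filter]
  refine ((edgeHeadEquiv d N).sum_comp fun p => φ p.1.1 p.1.2).trans ?_
  exact (Finset.sum_subtype _ (by simp) fun p : Fin d × GridVertex d N => φ p.1 p.2).symm

lemma sum_applyMatrix_gridIncidence_sq_le (u : EuclideanSpace ℝ (GridVertex d N)) :
    ∑ e, applyMatrix (gridIncidence d N) u e ^ 2 ≤ 4 * d * ‖u‖ ^ 2 := by
  have hconst : ∀ p : Fin d → GridVertex d N → Prop, ∀ [∀ j w, Decidable (p j w)],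
      ∑ j, ∑ w, (if p j w then u w ^ 2 else 0) ≤ d * ‖u‖ ^ 2 := by
    intro p _
    calc ∑ j, ∑ w, (if p j w then u w ^ 2 else 0) ≤ ∑ _j : Fin d, ∑ w, u w ^ 2 := by
          gcongr with j _ w _
          split_ifs
          · exact le_rfl
          · positivity
      _ = d * ‖u‖ ^ 2 := by simp [EuclideanSpace.real_norm_sq_eq]
  calc ∑ e, applyMatrix (gridIncidence d N) u e ^ 2
      ≤ ∑ e : GridEdge d N, (2 * u (edgeHead e) ^ 2 + 2 * u (edgeTail e) ^ 2) := by
        refine Finset.sum_le_sum fun e _ => ?_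
        rw [applyMatrix_gridIncidence]
        nlinarith [sq_nonneg (u (edgeHead e) + u (edgeTail e))]
    _ ≤ 2 * (d * ‖u‖ ^ 2) + 2 * (d * ‖u‖ ^ 2) := by
        rw [Finset.sum_add_distrib, ← Finset.mul_sum, ← Finset.mul_sum,
          sum_edgeHead fun _ w => u w ^ 2, sum_edgeTail fun _ w => u w ^ 2]
        gcongr <;> apply hconst
    _ = 4 * d * ‖u‖ ^ 2 := by ring

/-- Summation by parts on the grid. -/
lemma sum_grid_by_parts (u : EuclideanSpace ℝ (GridVertex d N)) (H : Fin d → GridVertex d N → ℝ)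
    (hH : ∀ j w k, H j (Function.update w j k) = H j w) (G : Fin d → ℕ → ℝ)
    (hG0 : ∀ j, G j 0 = 0) (hGN : ∀ j, G j N = 0) :
    ∑ w, (∑ j, (G j ((w j : ℕ) + 1) - G j (w j)) * H j w) * u w
      = -∑ e : GridEdge d N, G e.1.1 ((edgeTail e e.1.1 : ℕ) + 1) * H e.1.1 (edgeTail e)
          * applyMatrix (gridIncidence d N) u e := by
  have hsplit : ∀ e : GridEdge d N, G e.1.1 ((edgeTail e e.1.1 : ℕ) + 1) * H e.1.1 (edgeTail e)
          * applyMatrix (gridIncidence d N) u e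
      = (fun j (w : GridVertex d N) => G j (w j) * H j w * u w) e.1.1 (edgeHead e)
        - (fun j (w : GridVertex d N) => G j ((w j : ℕ) + 1) * H j w * u w) e.1.1 (edgeTail e) := by
    intro e
    have h1 : H e.1.1 (edgeHead e) = H e.1.1 (edgeTail e) := hH _ _ _
    simp only [edgeHead_apply_self, h1, applyMatrix_gridIncidence]
    ring
  rw [Finset.sum_congr rfl fun e _ => hsplit e, Finset.sum_sub_distrib,
    sum_edgeHead fun j w => G j (w j) * H j w * u w,
    sum_edgeTail fun j w => G j ((w j : ℕ) + 1) * H j w * u w, ← Finset.sum_sub_distrib, ← Finset.sum_neg_distrib]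
  simp_rw [Finset.sum_mul]
  rw [Finset.sum_comm]
  refine Finset.sum_congr rfl fun j _ => ?_
  rw [← Finset.sum_sub_distrib, ← Finset.sum_neg_distrib]
  refine Finset.sum_congr rfl fun w _ => ?_
  -- Vertices with no edge on one side contribute nothing, because `G` vanishes at `0` and at `N`.
  have h1 : (if 0 < (w j : ℕ) then G j (w j) * H j w * u w else 0) = G j (w j) * H j w * u w := by
    split_ifs with h
    · rfl
    · rw [Nat.eq_zero_of_not_pos h, hG0]; ring
  have h2 : (if (w j : ℕ) + 1 < N then G j ((w j : ℕ) + 1) * H j w * u w else 0)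
      = G j ((w j : ℕ) + 1) * H j w * u w := by
    split_ifs with h
    · rfl
    · have : (w j : ℕ) + 1 = N := by have := (w j).2; omega
      rw [this, hGN]; ring
  rw [h1, h2]
  ring

/-! ### Box flows and the centering inverse -/

lemma prod_ite_lt_ite_gt (a b c : Fin d → ℝ) (j : Fin d) :
    ∏ l, (if l < j then a l else if j < l then b l else c l)
      = c j * ((∏ l with l < j, a l) * ∏ l with j < l, b l) := by
  have hc : c j = ∏ l, if l = j then c l else 1 := by simp
  rw [hc, Finset.prod_filter, Finset.prod_filter, ← Finset.prod_mul_distrib,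
    ← Finset.prod_mul_distrib]
  refine Finset.prod_congr rfl fun l _ => ?_
  rcases lt_trichotomy l j with h | h | h
  · simp [h, h.ne, h.not_gt]
  · simp [h]
  · simp [h, h.ne', h.not_gt]

/-- The product of the one-dimensional window weights. -/
noncomputable def boxWeight (L : ℕ) (v w : GridVertex d N) : ℝ := ∏ l, windowWeight N L (v l) (w l)

/-- The flow, along the edge `e`, transporting the uniform distribution on the box of side `L + 1`
attached to `v` to that on the box of side `L`, one coordinate after the other. -/
noncomputable def boxFlow (L : ℕ) (e : GridEdge d N) : EuclideanSpace ℝ (GridVertex d N) :=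
  WithLp.toLp 2 fun v => ∏ l,
    if l < e.1.1 then windowWeight N L (v l) (edgeTail e l)
    else if e.1.1 < l then windowWeight N (L + 1) (v l) (edgeTail e l)
    else windowFlow N L (v l) ((edgeTail e l : ℕ) + 1)

lemma sum_boxWeight_sub_mul {L : ℕ} (hL : 1 ≤ L) (hLN : L + 1 ≤ N)
    (u : EuclideanSpace ℝ (GridVertex d N)) (v : GridVertex d N) :
    ∑ w, (boxWeight L v w - boxWeight (L + 1) v w) * u w
      = -∑ e, boxFlow L e v * applyMatrix (gridIncidence d N) u e := by
  have h := sum_grid_by_parts u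
    (fun j w => (∏ l with l < j, windowWeight N L (v l) (w l))
      * ∏ l with j < l, windowWeight N (L + 1) (v l) (w l))
    (fun j w k => by
      congr 1 <;>
      · refine Finset.prod_congr rfl fun l hl => ?_
        have hlj : l ≠ j := by
          have := (Finset.mem_filter.1 hl).2
          intro h; rw [h] at this; exact lt_irrefl _ this
        rw [Function.update_of_ne hlj])
    (fun j i => windowFlow N L (v j) i) (fun j => windowFlow_zero N L _)
    (fun j => windowFlow_self hL hLN _)
  refine Eq.trans (Finset.sum_congr rfl fun w _ => ?_) (h.trans ?_)
  · congr 1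
    -- Ordered telescoping of a difference of products: coordinates below `j` already carry side
    -- `L`, those above `j` still carry side `L + 1`, and the factor at `j` is an increment of
    -- `windowFlow`.
    have hp := Finset.prod_add_ordered Finset.univ
      (fun l => windowWeight N (L + 1) (v l) (w l))
      (fun l => windowWeight N L (v l) (w l) - windowWeight N (L + 1) (v l) (w l))
    simp only [add_sub_cancel] at hp
    rw [boxWeight, boxWeight, hp, add_sub_cancel_left]
    refine Finset.sum_congr rfl fun j _ => ?_
    rw [windowWeight_sub_windowWeight, mul_assoc]
  · congr 1
    refine Finset.sum_congr rfl fun e _ => ?_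
    congr 1
    exact (prod_ite_lt_ite_gt (fun l => windowWeight N L (v l) (edgeTail e l))
      (fun l => windowWeight N (L + 1) (v l) (edgeTail e l))
      (fun l => windowFlow N L (v l) ((edgeTail e l : ℕ) + 1)) e.1.1).symm

/-- For a fixed edge the flow is a product of functions of the separate coordinates of `v`, so its
squared norm factors into `d` one-dimensional sums, each at most `4 / L`. -/
lemma norm_boxFlow_sq_le {L : ℕ} (hL : 1 ≤ L) (hLN : L + 1 ≤ N) (e : GridEdge d N) :
    ‖boxFlow L e‖ ^ 2 ≤ (4 / (L : ℝ)) ^ d := by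
  have h : ‖boxFlow L e‖ ^ 2 = ∏ l, ∑ x : Fin N,
      (if l < e.1.1 then windowWeight N L x (edgeTail e l)
        else if e.1.1 < l then windowWeight N (L + 1) x (edgeTail e l)
        else windowFlow N L x ((edgeTail e l : ℕ) + 1)) ^ 2 := by
    rw [Finset.prod_univ_sum, Fintype.piFinset_univ, EuclideanSpace.real_norm_sq_eq]
    refine Finset.sum_congr rfl fun v _ => ?_
    rw [Finset.prod_pow]
    rfl
  rw [h]
  refine (Finset.prod_le_prod (g := fun _ => 4 / (L : ℝ))
    (fun l _ => Finset.sum_nonneg fun x _ => sq_nonneg _) fun l _ => ?_).trans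
    (le_of_eq (by rw [Finset.prod_const, Finset.card_univ, Fintype.card_fin]))
  split_ifs
  · exact sum_windowWeight_sq_le N L _ hL
  · refine (sum_windowWeight_sq_le N (L + 1) _ (by omega)).trans ?_
    have : (0 : ℝ) < L := by exact_mod_cast hL
    push_cast
    gcongr
    linarith
  · exact sum_windowFlow_sq_le hL hLN _

lemma boxWeight_one (v w : GridVertex d N) : boxWeight 1 v w = if v = w then 1 else 0 := by
  unfold boxWeight
  simp_rw [fun l => windowWeight_one (y := (w l : ℕ)) (v l).2]
  rw [Finset.prod_ite_zero]
  simp [funext_iff, Fin.ext_iff]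

lemma boxWeight_full (v w : GridVertex d N) :
    boxWeight N v w = 1 / (Fintype.card (GridVertex d N) : ℝ) := by
  unfold boxWeight
  simp_rw [fun l => windowWeight_full (x := (v l : ℕ)) (w l).2]
  simp

/-- The total flow along the edge `e`, summed over all scales. -/
noncomputable def gridFlow (e : GridEdge d N) : EuclideanSpace ℝ (GridVertex d N) :=
  -∑ k ∈ Finset.range (N - 1), boxFlow (k + 1) e

/-- Box averages telescope from side `1`, where the average is `u v`, to side `N`, where it is the
mean of `u`. The sign in `gridFlow` cancels the one from summation by parts. -/
lemma isCenteringInverse_gridFlow (hN : 1 ≤ N) :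
    IsCenteringInverse (gridIncidence d N) gridFlow := by
  intro u v
  have htel := Finset.sum_range_sub' (fun k => ∑ w, boxWeight (k + 1) v w * u w) (N - 1)
  have h1 : ∑ w, boxWeight (0 + 1) v w * u w = u v := by
    simp [boxWeight_one]
  have h2 : ∑ w, boxWeight (N - 1 + 1) v w * u w
      = (∑ w, u w) / (Fintype.card (GridVertex d N) : ℝ) := by
    rw [Nat.sub_add_cancel hN]
    simp_rw [boxWeight_full]
    rw [← Finset.mul_sum, one_div_mul_eq_div]
  rw [h1, h2] at htel
  rw [← htel]
  have h3 : ∀ k ∈ Finset.range (N - 1), ∑ w, boxWeight (k + 1) v w * u w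
        - ∑ w, boxWeight (k + 1 + 1) v w * u w
      = -∑ e, boxFlow (k + 1) e v * applyMatrix (gridIncidence d N) u e := by
    intro k hk
    have := Finset.mem_range.1 hk
    rw [← sum_boxWeight_sub_mul (by omega) (by omega), ← Finset.sum_sub_distrib]
    simp_rw [sub_mul]
  rw [Finset.sum_congr rfl h3, Finset.sum_neg_distrib, Finset.sum_comm, ← Finset.sum_neg_distrib]
  refine Finset.sum_congr rfl fun e _ => ?_
  simp [gridFlow, Finset.sum_mul]

lemma norm_boxFlow_le (hd : 3 ≤ d) {L : ℕ} (hL : 1 ≤ L) (hLN : L + 1 ≤ N) (e : GridEdge d N) :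
    ‖boxFlow L e‖ ≤ 2 ^ d * (1 / (L : ℝ) ^ (3 / 2 : ℝ)) := by
  have hL1 : (1 : ℝ) ≤ L := by exact_mod_cast hL
  refine (sq_le_sq₀ (norm_nonneg _) (by positivity)).1 ((norm_boxFlow_sq_le hL hLN e).trans ?_)
  have h : ((L : ℝ) ^ (3 / 2 : ℝ)) ^ 2 = (L : ℝ) ^ 3 := by
    rw [← Real.rpow_natCast, ← Real.rpow_mul (by positivity)]
    norm_num
  -- The comparison becomes `4 ^ d / L ^ d ≤ 4 ^ d / L ^ 3`, which holds since `L ≥ 1` and `d ≥ 3`.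
  rw [mul_pow, div_pow, div_pow, one_pow, h, ← pow_mul, mul_comm d 2, pow_mul, mul_one_div]
  norm_num
  gcongr

/-- In dimension at least three the columns of the centering inverse are bounded uniformly in the
side length of the grid. -/
theorem exists_norm_gridFlow_le (hd : 3 ≤ d) :
    ∃ ρ : ℝ, 0 < ρ ∧ ∀ (N : ℕ) (e : GridEdge d N), ‖gridFlow e‖ ≤ ρ := by
  have hsum : Summable fun L : ℕ => 1 / (L : ℝ) ^ (3 / 2 : ℝ) :=
    Real.summable_one_div_nat_rpow.2 (by norm_num)
  have hsum' := (summable_nat_add_iff 1).2 hsum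
  have h0 : 0 ≤ ∑' k : ℕ, 1 / ((k + 1 : ℕ) : ℝ) ^ (3 / 2 : ℝ) :=
    tsum_nonneg fun k => by positivity
  refine ⟨2 ^ d * (∑' k : ℕ, 1 / ((k + 1 : ℕ) : ℝ) ^ (3 / 2 : ℝ)) + 1, by positivity,
    fun N e => ?_⟩
  rw [gridFlow, norm_neg]
  calc ‖∑ k ∈ Finset.range (N - 1), boxFlow (k + 1) e‖
      ≤ ∑ k ∈ Finset.range (N - 1), 2 ^ d * (1 / ((k + 1 : ℕ) : ℝ) ^ (3 / 2 : ℝ)) := by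
        refine norm_sum_le_of_le _ fun k hk => ?_
        have := Finset.mem_range.1 hk
        exact norm_boxFlow_le hd (by omega) (by omega) e
    _ ≤ 2 ^ d * ∑' k : ℕ, 1 / ((k + 1 : ℕ) : ℝ) ^ (3 / 2 : ℝ) := by
        rw [← Finset.mul_sum]
        gcongr
        exact hsum'.sum_le_tsum _ fun k _ => by positivity
    _ ≤ _ := by linarith

end Grid

/-! ### The noise event -/

section NoiseEvent

variable {V E Ω : Type*} [Fintype V] [DecidableEq V] [Fintype E] [MeasurableSpace Ω]

/-- A union bound: all the noise terms of the oracle inequality are controlled on one event. -/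
lemma exists_noise_event [Nonempty V] {P : Measure Ω} [IsProbabilityMeasure P]
    {ε : Ω → EuclideanSpace ℝ V} {σ : ℝ} (hσ : 0 < σ)
    (hε : HasLaw ε (multivariateGaussian 0 (σ ^ 2 • (1 : Matrix V V ℝ))) P)
    {S : E → EuclideanSpace ℝ V} {ρ : ℝ} (hρ : 0 < ρ) (hS : ∀ e, ‖S e‖ ≤ ρ)
    {q : ℝ} (hq : 1 ≤ q) (hE : (Fintype.card E : ℝ) ≤ q * Fintype.card V)
    {δ : ℝ} (hδ0 : 0 < δ) (hδ1 : δ < 1) :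
    ∃ A : Set Ω, MeasurableSet A ∧ ENNReal.ofReal (1 - 2 * δ) ≤ P A ∧ ∀ ω ∈ A,
      (∀ e, |inner ℝ (S e) (ε ω)| ≤ σ * ρ * √(2 * (1 + Real.log (2 * q)))
        * √(Real.log (Real.exp 1 * Fintype.card V / δ))) ∧
      |∑ v, ε ω v| ≤ 2 * σ * √(Real.log (Real.exp 1 / δ)) * √(Fintype.card V : ℝ) := by
  have hn1 : (1 : ℝ) ≤ Fintype.card V := by exact_mod_cast Fintype.card_pos
  set n : ℝ := (Fintype.card V : ℝ) with hn
  have hn0 : 0 < n := by linarith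
  have he := Real.exp_pos 1
  have he2 : 2 ≤ Real.exp 1 := by have := Real.add_one_le_exp 1; linarith
  set ℓ := Real.log (Real.exp 1 * n / δ) with hℓ
  have hexpℓ : Real.exp (-ℓ) = δ / (Real.exp 1 * n) := by
    rw [hℓ, Real.exp_neg, Real.exp_log (by positivity), inv_div]
  have hℓ1 : 1 ≤ ℓ := by
    rw [hℓ, Real.le_log_iff_exp_le (by positivity), le_div_iff₀ hδ0]
    nlinarith
  have hlq : 0 ≤ Real.log (2 * q) := Real.log_nonneg (by linarith)
  set τ := σ * ρ * √(2 * (1 + Real.log (2 * q))) * √ℓ with hτ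
  set Ld := Real.log (Real.exp 1 / δ) with hLd
  have hexpLd : Real.exp (-Ld) = δ / Real.exp 1 := by
    rw [hLd, Real.exp_neg, Real.exp_log (by positivity), inv_div]
  have hLd1 : 1 ≤ Ld := by
    rw [hLd, Real.le_log_iff_exp_le (by positivity), le_div_iff₀ hδ0]
    nlinarith
  set t := 2 * σ * √Ld * √n with ht
  let one : EuclideanSpace ℝ V := WithLp.toLp 2 fun _ => 1
  have hone : ‖one‖ ≤ √n := by
    rw [EuclideanSpace.norm_eq]; simp [one, hn]
  have hinner : ∀ x : EuclideanSpace ℝ V, inner ℝ one x = ∑ v, x v := by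
    intro x; simp [PiLp.inner_apply, one]
  have hbE : ∀ e, P {ω | τ ≤ |inner ℝ (S e) (ε ω)|} ≤ ENNReal.ofReal (δ / (q * n)) := by
    intro e
    refine (measure_le_abs_inner_le hε (hS e) (by positivity)).trans
      (ENNReal.ofReal_le_ofReal ?_)
    have hexp : -τ ^ 2 / (2 * (σ * ρ) ^ 2) = -((1 + Real.log (2 * q)) * ℓ) := by
      rw [hτ, mul_pow, mul_pow, Real.sq_sqrt (by positivity), Real.sq_sqrt (by positivity)]
      field_simp
    -- Uses `ℓ ≥ 1`. The summand `log (2 * q)` pays for the factor `2` of the two-sided tail and for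
    -- the `q * n` edges.
    have hle : -((1 + Real.log (2 * q)) * ℓ) ≤ -Real.log (2 * q) + -ℓ := by nlinarith
    rw [hexp]
    calc 2 * Real.exp (-((1 + Real.log (2 * q)) * ℓ))
        ≤ 2 * Real.exp (-Real.log (2 * q) + -ℓ) := by gcongr
      _ = 2 * ((2 * q)⁻¹ * (δ / (Real.exp 1 * n))) := by
          rw [Real.exp_add, hexpℓ, Real.exp_neg, Real.exp_log (by positivity)]
      _ = δ / (q * n) / Real.exp 1 := by field_simp
      _ ≤ δ / (q * n) := div_le_self (by positivity) (by linarith)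
  have hb1 : P {ω | t ≤ |inner ℝ one (ε ω)|} ≤ ENNReal.ofReal δ := by
    refine (measure_le_abs_inner_le hε hone (by positivity)).trans
      (ENNReal.ofReal_le_ofReal ?_)
    -- The factor `2` in `t` yields the tail `2 (δ / e)²`, which is below `δ`.
    have hexp : -t ^ 2 / (2 * (σ * √n) ^ 2) = -Ld + -Ld := by
      rw [ht, mul_pow, mul_pow, mul_pow σ, Real.sq_sqrt (by positivity), Real.sq_sqrt hn0.le]
      field_simp
      ring
    rw [hexp, Real.exp_add, hexpLd]
    have h1 : δ / Real.exp 1 ≤ 1 / 2 := by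
      rw [div_le_div_iff₀ he (by norm_num)]; linarith
    have h2 : δ / Real.exp 1 ≤ δ := div_le_self hδ0.le (by linarith)
    have h3 : 0 ≤ δ / Real.exp 1 := by positivity
    nlinarith
  set B : Set Ω := (⋃ e, {ω | τ ≤ |inner ℝ (S e) (ε ω)|}) ∪ {ω | t ≤ |inner ℝ one (ε ω)|} with hB
  have hPB : P B ≤ ENNReal.ofReal (2 * δ) := by
    rw [two_mul, ENNReal.ofReal_add hδ0.le hδ0.le]
    refine (measure_union_le _ _).trans (add_le_add ?_ hb1)
    refine (measure_iUnion_fintype_le P _).trans ((Finset.sum_le_sum fun e _ => hbE e).trans ?_)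
    rw [Finset.sum_const, Finset.card_univ, nsmul_eq_mul, ← ENNReal.ofReal_natCast,
      ← ENNReal.ofReal_mul (by positivity)]
    apply ENNReal.ofReal_le_ofReal
    rw [mul_div_assoc', div_le_iff₀ (by positivity)]
    nlinarith
  -- `ε` is only almost everywhere measurable, so the bad set is replaced by a measurable hull of
  -- the same measure.
  refine ⟨(toMeasurable P B)ᶜ, (measurableSet_toMeasurable P B).compl, ?_, fun ω hω => ?_⟩
  · rw [prob_compl_eq_one_sub (measurableSet_toMeasurable P B), measure_toMeasurable,
      ENNReal.ofReal_sub _ (by positivity), ENNReal.ofReal_one]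
    exact tsub_le_tsub_left hPB 1
  · have hωB : ω ∉ B := fun h => hω (subset_toMeasurable P B h)
    simp only [hB, Set.mem_union, Set.mem_iUnion, Set.mem_ofPred_eq, not_or, not_exists,
      not_le] at hωB
    refine ⟨fun e => (hωB.1 e).le, ?_⟩
    rw [← hinner]
    exact hωB.2.le

end NoiseEvent

/-! ### Choices of the active set -/

section Consequences

variable {E : Type*} [Fintype E]

lemma restrictTo_compl_empty [DecidableEq E] (x : E → ℝ) : restrictTo (∅ : Finset E)ᶜ x = x := by
  funext e; simp [restrictTo]

open Classical in
lemma l1Norm_restrictTo_compl_support [DecidableEq E] (x : E → ℝ) :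
    l1Norm (restrictTo (Finset.univ.filter fun e => x e ≠ 0)ᶜ x) = 0 := by
  refine Finset.sum_eq_zero fun e _ => ?_
  simp [restrictTo]

lemma one_le_l0Norm {x : E → ℝ} (h : 0 < l1Norm x) : 1 ≤ l0Norm x := by
  classical
  obtain ⟨e, -, he⟩ := Finset.exists_ne_zero_of_sum_ne_zero h.ne'
  exact Finset.card_pos.2 ⟨e, by simpa using he⟩

lemma card_gridEdge_le (d N : ℕ) :
    (Fintype.card (GridEdge d N) : ℝ) ≤ d * Fintype.card (GridVertex d N) := by
  have h := Fintype.card_subtype_le fun e : Fin d × GridVertex d N => (e.2 e.1 : ℕ) + 1 < N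
  rw [Fintype.card_prod, Fintype.card_fin] at h
  exact_mod_cast h

/-- Combining the bounds given by an empty and a full active set. -/
lemma le_min_bound {M a z σ c C K n lam ℓ Ld : ℝ} (hn : 0 < n) (hσ : 0 < σ)
    (hc : 0 < c) (hC : 0 < C) (hK : 4 * c + C ≤ K) (ha : 0 ≤ a) (hz : 0 ≤ z) (hℓ : 0 ≤ ℓ)
    (hLd : 0 ≤ Ld) (hlam : lam ≤ c * σ * ℓ / n)
    (h1 : M ≤ 4 * lam * a + C * σ ^ 2 / n * Ld)
    (h2 : M ≤ C * σ ^ 2 / n * (z * ℓ + Ld)) :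
    M ≤ K * (min (σ * a) (σ ^ 2 * z) * ℓ + σ ^ 2 * Ld) / n := by
  rcases min_cases (σ * a) (σ ^ 2 * z) with ⟨h, -⟩ | ⟨h, -⟩ <;> rw [h]
  · calc M ≤ 4 * (c * σ * ℓ / n) * a + C * σ ^ 2 / n * Ld := h1.trans (by gcongr)
      _ = ((4 * c) * (σ * a * ℓ) + C * (σ ^ 2 * Ld)) / n := by ring
      _ ≤ (K * (σ * a * ℓ) + K * (σ ^ 2 * Ld)) / n := by gcongr <;> linarith
      _ = _ := by ring
  · calc M ≤ C * (σ ^ 2 * z * ℓ + σ ^ 2 * Ld) / n := h2.trans (le_of_eq (by ring))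
      _ ≤ _ := by gcongr; linarith

/-- The term `σ² Ld` is absorbed when both arguments of the minimum are at least `σ²`. -/
lemma le_min_absorb {a z σ K n ℓ Ld : ℝ} (hn : 0 < n) (hσ : 0 < σ) (hK : 0 ≤ K) (ha : σ ≤ a)
    (hz : 1 ≤ z) (hℓ : 0 ≤ ℓ) (hLd : Ld ≤ ℓ) :
    K * (min (σ * a) (σ ^ 2 * z) * ℓ + σ ^ 2 * Ld) / n
      ≤ 2 * K * (min (σ * a) (σ ^ 2 * z) / n) * ℓ := by
  have hmin : σ ^ 2 ≤ min (σ * a) (σ ^ 2 * z) :=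
    le_min (by rw [sq]; gcongr) (le_mul_of_one_le_right (by positivity) hz)
  calc K * (min (σ * a) (σ ^ 2 * z) * ℓ + σ ^ 2 * Ld) / n
      ≤ K * (min (σ * a) (σ ^ 2 * z) * ℓ + min (σ * a) (σ ^ 2 * z) * ℓ) / n := by
        have : σ ^ 2 * Ld ≤ min (σ * a) (σ ^ 2 * z) * ℓ :=
          (mul_le_mul_of_nonneg_left hLd (by positivity)).trans
            (mul_le_mul_of_nonneg_right hmin hℓ)
        gcongr
    _ = _ := by ring

end Consequences

/-! ### The final bounds and their constants -/

theorem corollary5 (d : ℕ) (hd : 3 ≤ d) :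
    ∃ c C K : ℝ, 0 < c ∧ 0 < C ∧ 0 < K ∧
      ∀ (N : ℕ) (_ : 1 ≤ N) (δ : ℝ) (_ : 0 < δ) (_ : δ < 1) (σ : ℝ) (_ : 0 < σ)
        (θstar : EuclideanSpace ℝ (GridVertex d N))
        {Ω : Type*} [MeasurableSpace Ω] (P : Measure Ω) [IsProbabilityMeasure P]
        (ε : Ω → EuclideanSpace ℝ (GridVertex d N))
        (_ : HasLaw ε (multivariateGaussian 0
          (σ ^ 2 • (1 : Matrix (GridVertex d N) (GridVertex d N) ℝ))) P),
        let n : ℝ := (N : ℝ) ^ d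
        let D := gridIncidence d N
        let lam : ℝ := c * σ * Real.sqrt (Real.log (Real.exp 1 * n / δ)) / n
        ∃ A : Set Ω, MeasurableSet A ∧ ENNReal.ofReal (1 - 2 * δ) ≤ P A ∧
          ∀ ω ∈ A, ∀ θhat : EuclideanSpace ℝ (GridVertex d N),
            IsTVDenoiser D lam (θstar + ε ω) θhat →
              mse θhat θstar ≤
                  (⨅ p : EuclideanSpace ℝ (GridVertex d N) × Finset (GridEdge d N),
                    (mse p.1 θstar
                      + 4 * lam * l1Norm (restrictTo p.2ᶜ (applyMatrix D p.1))
                      + C * σ ^ 2 / n * (p.2.card * Real.log (Real.exp 1 * n / δ)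
                          + Real.log (Real.exp 1 / δ)))) ∧
              mse θhat θstar ≤
                  K * (min (σ * l1Norm (applyMatrix D θstar))
                          (σ ^ 2 * l0Norm (applyMatrix D θstar))
                        * Real.log (Real.exp 1 * n / δ)
                      + σ ^ 2 * Real.log (Real.exp 1 / δ)) / n ∧
              (σ ≤ l1Norm (applyMatrix D θstar) →
                mse θhat θstar ≤
                  K * (min (σ * l1Norm (applyMatrix D θstar))
                          (σ ^ 2 * l0Norm (applyMatrix D θstar)) / n)
                      * Real.log (Real.exp 1 * n / δ)) := by
  obtain ⟨ρ, hρ, hflow⟩ := exists_norm_gridFlow_le hd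
  have hd1 : (1 : ℝ) ≤ d := by exact_mod_cast (by omega : 1 ≤ d)
  have hlogd : 0 ≤ Real.log (2 * d) := Real.log_nonneg (by linarith)
  -- Chosen so that `lam * n / 2` is exactly the noise level of `exists_noise_event` with `q = d`.
  set c : ℝ := 2 * (ρ * √(2 * (1 + Real.log (2 * d)))) with hc
  have hc0 : 0 < c := by positivity
  -- The `16` is `4 R² / (σ² Ld)` for `R = 2 σ √Ld`; the other term is `4 b c²` with `b = 4 d`.
  set C : ℝ := 16 + 16 * d * c ^ 2 with hC
  have hC0 : 0 < C := by positivity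
  -- The first consequence needs only `4 * c + C`; the doubling absorbs the `σ² Ld` term in the
  -- second.
  refine ⟨c, C, 2 * (4 * c + C), hc0, hC0, by positivity, ?_⟩
  intro N hN δ hδ0 hδ1 σ hσ θstar Ω _ P _ ε hε n D lam
  have : NeZero N := ⟨by omega⟩
  have hcard : (Fintype.card (GridVertex d N) : ℝ) = n := by simp [n]
  have hn1 : 1 ≤ n := one_le_pow₀ (by exact_mod_cast hN)
  have hn0 : 0 < n := by linarith
  obtain ⟨A, hA, hPA, hω⟩ := exists_noise_event hσ hε hρ (hflow N) hd1 (card_gridEdge_le d N)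
    hδ0 hδ1
  rw [hcard] at hω
  refine ⟨A, hA, hPA, fun ω hωA θhat hθ => ?_⟩
  obtain ⟨hτ, hR⟩ := hω ω hωA
  have he := Real.exp_pos 1
  have hLd1 : 1 ≤ Real.log (Real.exp 1 / δ) := by
    rw [Real.le_log_iff_exp_le (by positivity), le_div_iff₀ hδ0]
    exact mul_le_of_le_one_right he.le hδ1.le
  have hLdℓ : Real.log (Real.exp 1 / δ) ≤ Real.log (Real.exp 1 * n / δ) := by
    apply Real.log_le_log (by positivity)
    gcongr
    exact le_mul_of_one_le_right he.le hn1
  set ℓ := Real.log (Real.exp 1 * n / δ) with hℓ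
  set Ld := Real.log (Real.exp 1 / δ) with hLd
  have hlam : lam = c * σ * √ℓ / n := rfl
  have hlam0 : 0 ≤ lam := by rw [hlam]; positivity
  have horacle : ∀ (θ : EuclideanSpace ℝ (GridVertex d N)) (T : Finset (GridEdge d N)),
      mse θhat θstar ≤ mse θ θstar + 4 * lam * l1Norm (restrictTo Tᶜ (applyMatrix D θ))
        + C * σ ^ 2 / n * (T.card * ℓ + Ld) := by
    intro θ T
    have h := hθ.mse_le (isCenteringInverse_gridFlow hN) (by positivity)
      sum_applyMatrix_gridIncidence_sq_le hlam0 (R := 2 * σ * √Ld) ?_ ?_ θ T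
    · rw [hcard] at h
      have hl := l1Norm_nonneg (restrictTo Tᶜ (applyMatrix D θ))
      have h1 : 4 * (2 * σ * √Ld) ^ 2 / n = 16 * σ ^ 2 / n * Ld := by
        rw [mul_pow, Real.sq_sqrt (by linarith)]; ring
      have h2 : 4 * (4 * d) * n * lam ^ 2 * T.card = 16 * d * c ^ 2 * σ ^ 2 / n * (T.card * ℓ) := by
        rw [hlam, div_pow, mul_pow, Real.sq_sqrt (by linarith)]
        field_simp
        ring
      have h3 : C * σ ^ 2 / n * (T.card * ℓ + Ld)
          = 16 * σ ^ 2 / n * Ld + 16 * d * c ^ 2 * σ ^ 2 / n * (T.card * ℓ)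
            + (16 * σ ^ 2 / n * (T.card * ℓ) + 16 * d * c ^ 2 * σ ^ 2 / n * Ld) := by
        rw [hC]; ring
      have h4 : 0 ≤ 16 * σ ^ 2 / n * (T.card * ℓ) + 16 * d * c ^ 2 * σ ^ 2 / n * Ld := by
        have : 0 ≤ ℓ := by linarith
        positivity
      have h5 : 2 * lam * l1Norm (restrictTo Tᶜ (applyMatrix D θ))
          ≤ 4 * lam * l1Norm (restrictTo Tᶜ (applyMatrix D θ)) := by gcongr; norm_num
      rw [h1, h2] at h
      rw [h3]
      linarith
    · intro e
      refine (hτ e).trans (le_of_eq ?_)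
      rw [hcard, hlam, hc]
      field_simp
    · rw [hcard]; exact hR
  have hself : mse θstar θstar = 0 := by simp [mse]
  -- The empty active set gives the `ℓ¹` rate; the support of `D θstar`, below, gives the `ℓ⁰` rate.
  have h1 := horacle θstar ∅
  rw [restrictTo_compl_empty, hself, Finset.card_empty, Nat.cast_zero, zero_mul, zero_add,
    zero_add] at h1
  classical
  have h2 := horacle θstar (Finset.univ.filter fun e => applyMatrix D θstar e ≠ 0)
  rw [l1Norm_restrictTo_compl_support, hself, mul_zero, zero_add, zero_add] at h2
  have hcard0 : (Finset.univ.filter fun e => applyMatrix D θstar e ≠ 0).card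
      = l0Norm (applyMatrix D θstar) := by
    unfold l0Norm; congr
  rw [hcard0] at h2
  -- `√ℓ ≤ ℓ` because `ℓ ≥ 1`; this puts both rates over the same logarithm.
  have hlamℓ : lam ≤ c * σ * ℓ / n := by
    rw [hlam]
    gcongr
    rw [Real.sqrt_le_left (by linarith)]
    exact le_self_pow₀ (by linarith) (by norm_num)
  have ha := l1Norm_nonneg (applyMatrix D θstar)
  have hbound : mse θhat θstar ≤ (4 * c + C) * (min (σ * l1Norm (applyMatrix D θstar))
      (σ ^ 2 * l0Norm (applyMatrix D θstar)) * ℓ + σ ^ 2 * Ld) / n :=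
    le_min_bound hn0 hσ hc0 hC0 le_rfl ha (by positivity) (by linarith) (by linarith) hlamℓ h1 h2
  have hmin : 0 ≤ min (σ * l1Norm (applyMatrix D θstar))
      (σ ^ 2 * l0Norm (applyMatrix D θstar)) := by
    apply le_min <;> positivity
  have hℓ0 : 0 ≤ ℓ := by linarith
  have hLd0 : 0 ≤ Ld := by linarith
  refine ⟨le_ciInf fun p => horacle p.1 p.2, hbound.trans ?_, fun hσa => hbound.trans ?_⟩
  · gcongr
    linarith
  · have h0 : (1 : ℝ) ≤ l0Norm (applyMatrix D θstar) := by
      exact_mod_cast one_le_l0Norm (hσ.trans_le hσa)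
    exact (le_min_absorb hn0 hσ (by positivity) hσa h0 hℓ0 hLdℓ)
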